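/- Let $k$ be a field of characteristic zero and let $D=k[d_1,\dots,d_n]\cong k[\chi_1,\dots,\chi_n]$ ($d_i\leftrightarrow\chi_i$) be the ring of differential operators with constant coefficients. Let $y^1,\dots,y^m$ be unknowns, $Dy=Dy^1+\dots+Dy^m\cong D^m$, and let $y^a_\mu=d_\mu y^a$ be the jet of order $|\mu|$ of $y^a$. A nonzero multi-index $\mu$ has class $i$ if $\mu_1=\dots=\mu_{i-1}=0$ and $\mu_i\neq 0$. A finite system $\Phi=(\Phi^\tau)$ of order $q\ge 1$ in $Dy$ is called involutive (in the given coordinates $d_1,\dots,d_n$) if its equations have order at most $q$ and can be divided into equations of class $n,\dots,$ class $1$, and remaining equations of order at most $q-1$, such that: an equation of class $i$ contains no jet of order $q$ and class $>i$; for each $i$ the equations of class $i$ are solved with respect to distinct (principal) jets of order $q$ and class $i$, that is, each of them contains its own principal jet with coefficient $1$ and does not contain the principal jets of the other equations of class $i$; and, calling $d_1,\dots,d_i$ multiplicative for an equation of class $i$, and no derivation multiplicative for a remaining equation, each nonmultiplicative prolongation $d_j\Phi^\tau$ is a $k$-linear combination of the equations and of their multiplicative prolongations. For a prime ideal $\mathfrak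 p$ of $D$ put $cd(D/\mathfrak p)=n-\mathrm{trd}(Q(D/\mathfrak p)/k)$, the transcendence degree being that of the field of fractions. For a finitely generated $D$-module $N$ let $cd_D(N)$ be the minimum of $cd(D/\mathfrak p)$ over the minimal primes $\mathfrak p$ of $\mathrm{ann}_D(N)$ (and $\infty$ if $N=0$). A $D$-module $M$ is $r$-pure if $cd_D(Dx)=r$ for every nonzero $x\in M$. **Corollary 3.10.** Let $\Phi$ be an involutive system of order $q\geq 1$ in $m$ unknowns, with $m$ arbitrary, and let $M=Dy/D\Phi$ be the $D$-module that it defines. Suppose that $cd_D(M)=r$. Then $M$ is $r$-pure if and only if the natural map $$M\longrightarrow k(\chi_1,\dots,\chi_{n-r})\otimes_{k[\chi_1,\dots,\chi_{n-r}]} M,\qquad x\mapsto 1\otimes x,$$ is injective. -/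

import Mathlib

namespace PartialLocalization

/-- The ring `D = k[d₁, …, dₙ]` of differential operators with constant coefficients,
identified with the polynomial ring `k[χ₁, …, χₙ]`. The variable `χᵢ` is `X (i - 1)`. -/
abbrev Ops (k : Type*) [Field k] (n : ℕ) : Type _ := MvPolynomial (Fin n) k

/-- The multi-index `μ` has class `i`: its components before `i` vanish and `μ i ≠ 0`. -/
def HasClass {n : ℕ} (μ : Fin n →₀ ℕ) (i : Fin n) : Prop :=
  μ i ≠ 0 ∧ ∀ j < i, μ j = 0

/-- A system of order `q`, written as a family of elements `Φ τ` of `Dy¹ + ⋯ + Dyᵐ`, is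
involutive in the given coordinates. The coefficient of the jet `y^a_μ` in `Φ τ` is
`(Φ τ a).coeff μ`.

`cls τ` is the class of the equation `Φ τ` when it has order `q`, and `⊥` for the remaining
equations, which have order at most `q - 1`. The derivation `d_j` is multiplicative for `Φ τ` when
`j ≤ cls τ`; thus no derivation is multiplicative for the remaining equations.
`pri τ` is the principal jet with respect to which an equation of order `q` is solved. -/
def IsInvolutive {k : Type*} [Field k] {n m p : ℕ} (q : ℕ) (Φ : Fin p → Fin m → Ops k n) : Prop :=
  ∃ (cls : Fin p → WithBot (Fin n)) (pri : Fin p → Fin m × (Fin n →₀ ℕ)),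
    -- the equations have order at most `q`
    (∀ τ a, (Φ τ a).totalDegree ≤ q) ∧
    -- the jets of order `q` that occur in `Φ τ` have class at most `cls τ`
    (∀ τ a μ i, μ.degree = q → HasClass μ i → (Φ τ a).coeff μ ≠ 0 → (i : WithBot (Fin n)) ≤ cls τ) ∧
    -- the equations of class `i` are solved with respect to jets of order `q` and class `i`
    (∀ τ (i : Fin n), cls τ = i →
      (pri τ).2.degree = q ∧ HasClass (pri τ).2 i ∧
      ∀ σ, cls σ = i → (Φ σ (pri τ).1).coeff (pri τ).2 = if σ = τ then 1 else 0) ∧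
    -- each nonmultiplicative prolongation is a linear combination of the equations and of
    -- their multiplicative prolongations
    (∀ τ (j : Fin n), ¬ (j : WithBot (Fin n)) ≤ cls τ →
      (MvPolynomial.X j : Ops k n) • Φ τ ∈
        Submodule.span k (Set.range Φ ∪
          {Ψ | ∃ σ, ∃ l : Fin n, (l : WithBot (Fin n)) ≤ cls σ ∧
            Ψ = (MvPolynomial.X l : Ops k n) • Φ σ}))

/-- The differential module `M = Dy / DΦ` defined by the system `Φ`. -/
abbrev SysModule {k : Type*} [Field k] {n m p : ℕ} (Φ : Fin p → Fin m → Ops k n) : Type _ :=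
  (Fin m → Ops k n) ⧸ Submodule.span (Ops k n) (Set.range Φ)

/-- The codimension `n - trd (Q (D / 𝔭) / k)` of a prime ideal `𝔭`. The subtraction does not
truncate, as `D / 𝔭` is generated by `n` elements over `k`. -/
noncomputable def primeCodim {k : Type*} [Field k] {n : ℕ} (𝔭 : Ideal (Ops k n)) : ℕ :=
  n - Cardinal.toNat (Algebra.trdeg k (FractionRing (Ops k n ⧸ 𝔭)))

/-- The codimension `cd_D(M)` of a `D`-module: the minimum of the codimensions of the minimal
primes of its annihilator. The zero module has codimension `⊤`. -/
noncomputable def codim {k : Type*} [Field k] {n : ℕ} (M : Type*) [AddCommGroup M]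
    [Module (Ops k n) M] : ℕ∞ :=
  ⨅ 𝔭 ∈ (Module.annihilator (Ops k n) M).minimalPrimes, (primeCodim 𝔭 : ℕ∞)

/-- `M` is `r`-pure: `cd(Dx) = r` for every nonzero `x` in `M`. -/
def IsPure (k : Type*) [Field k] (n r : ℕ) (M : Type*) [AddCommGroup M] [Module (Ops k n) M] :
    Prop :=
  ∀ x : M, x ≠ 0 → codim (k := k) (n := n) (Submodule.span (Ops k n) {x}) = (r : ℕ∞)

/-- The subring `k[χ₁, …, χₛ]` of `D = k[χ₁, …, χₙ]`. -/
noncomputable abbrev FirstVars (k : Type*) [Field k] (n s : ℕ) : Subalgebra k (Ops k n) :=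
  MvPolynomial.supported k {i : Fin n | (i : ℕ) < s}

/-- The natural map `x ↦ 1 ⊗ x` from `M` to its partial localization `k(χ₁, …, χₛ) ⊗ M`, where
`k(χ₁, …, χₛ)` is the field of fractions of `k[χ₁, …, χₛ]` and the tensor product is taken over
`k[χ₁, …, χₛ]`. -/
noncomputable def toPartialLocalization (k : Type*) [Field k] (n s : ℕ) (M : Type*)
    [AddCommGroup M] [Module (Ops k n) M] (x : M) :
    TensorProduct (FirstVars k n s) (FractionRing (FirstVars k n s)) M :=
  TensorProduct.tmul (FirstVars k n s) (1 : FractionRing (FirstVars k n s)) x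

end PartialLocalization

/-! The multiplicative prolongations of an involutive system span `DΦ` over `k`
(`prolongation_mem_span_multiplicative`), and the leading jets of a combination of them cannot all
cancel (`exists_coeff_ne_zero`). Hence a jet of order `q` and class `i` that is not principal
generates a free `k[χ₁, …, χᵢ]`-module inside `M` (`eq_zero_of_smul_parametric_mem`), which forces
`cd M ≤ n - i`. As `cd M = r`, all jets of order `q` and class `> n - r` are principal, and solving
for them makes `M` finite over `A = k[χ₁, …, χₙ₋ᵣ]` (`finite_firstVars`).

For `x ≠ 0` the ring `D / ann(Dx)` is then integral over the image of `A`. Every minimal prime of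
`ann(Dx)` has codimension at least `r`, with equality exactly when it meets `A` in zero. So `cd(Dx)
= r` if and only if no nonzero element of `A` kills `x`, and purity is torsion-freeness over `A`,
that is, injectivity of the localization map (`isPure_iff_injective`). -/

namespace PartialLocalization

open MvPolynomial

/-! ### Multi-indices: class and weight. -/

section MultiIndex

variable {n : ℕ}

/-- The weight `∑ (i + 1) νᵢ`. -/
def indexWeight (ν : Fin n →₀ ℕ) : ℕ := ∑ i : Fin n, ((i : ℕ) + 1) * ν i

theorem indexWeight_add (μ ν : Fin n →₀ ℕ) :
    indexWeight (μ + ν) = indexWeight μ + indexWeight ν := by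
  simp [indexWeight, mul_add, Finset.sum_add_distrib]

theorem indexWeight_single (j : Fin n) : indexWeight (Finsupp.single j 1) = j + 1 := by
  classical
  simp [indexWeight, Finsupp.single_apply]

theorem exists_hasClass {μ : Fin n →₀ ℕ} (h : μ ≠ 0) : ∃ i, HasClass μ i := by
  have hne : μ.support.Nonempty := Finsupp.support_nonempty_iff.2 h
  refine ⟨μ.support.min' hne, by simpa using μ.support.min'_mem hne, fun j hj => ?_⟩
  by_contra hj0
  exact absurd (μ.support.min'_le j (by simpa using hj0)) (not_le.2 hj)

theorem HasClass.le {μ : Fin n →₀ ℕ} {i j : Fin n} (h : HasClass μ i) (hj : μ j ≠ 0) : i ≤ j :=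
  not_lt.1 fun hlt => hj (h.2 j hlt)

theorem HasClass.unique {μ : Fin n →₀ ℕ} {i j : Fin n} (h : HasClass μ i) (h' : HasClass μ j) :
    i = j :=
  le_antisymm (h.le h'.1) (h'.le h.1)

/-- This makes the splitting of a jet into a multiplicative part and a leading jet unique. Once the
degrees agree, the weight difference is `∑ (j - c)(ν j - ν₀ j)`. Each term is nonnegative, because
`μ₀` vanishes below `c` and `ν₀` above it, while the sum is at most zero. -/
theorem eq_of_add_eq_add {ν ν₀ μ μ₀ : Fin n →₀ ℕ} {c : Fin n} (h : ν + μ = ν₀ + μ₀)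
    (hν : ν.degree ≤ ν₀.degree) (hμ : μ.degree ≤ μ₀.degree)
    (hw : ν.degree = ν₀.degree → indexWeight ν ≤ indexWeight ν₀)
    (hc : HasClass μ₀ c) (hν₀ : ∀ j, ν₀ j ≠ 0 → j ≤ c) : ν = ν₀ ∧ μ = μ₀ := by
  have hdeg : ν.degree = ν₀.degree := by
    have := congrArg Finsupp.degree h
    simp only [map_add] at this
    omega
  have hw := hw hdeg
  have happ : ∀ j, ν j + μ j = ν₀ j + μ₀ j := fun j => by simpa using DFunLike.congr_fun h j
  have hterm : ∀ j ∈ (Finset.univ : Finset (Fin n)), 0 ≤ ((j : ℤ) - c) * ((ν j : ℤ) - ν₀ j) := by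
    intro j _
    have := happ j
    rcases lt_trichotomy j c with hj | rfl | hj
    · have h0 := hc.2 j hj
      have : (j : ℕ) < c := hj
      apply mul_nonneg_of_nonpos_of_nonpos <;> omega
    · simp
    · have h0 : ν₀ j = 0 := by
        by_contra h0
        exact absurd (hν₀ j h0) (not_le.2 hj)
      have : (c : ℕ) < j := hj
      apply mul_nonneg <;> omega
  have hdeg' : (∑ j, ((ν j : ℤ) - ν₀ j)) = 0 := by
    rw [Finsupp.degree_eq_sum, Finsupp.degree_eq_sum] at hdeg
    rw [Finset.sum_sub_distrib, sub_eq_zero]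
    exact_mod_cast hdeg
  have hw' : (∑ j : Fin n, ((j : ℤ) + 1) * ((ν j : ℤ) - ν₀ j)) ≤ 0 := by
    simp only [indexWeight] at hw
    simp only [mul_sub, Finset.sum_sub_distrib, sub_nonpos]
    exact_mod_cast hw
  have hsum : (∑ j : Fin n, ((j : ℤ) - c) * ((ν j : ℤ) - ν₀ j)) ≤ 0 := by
    have : (∑ j : Fin n, ((j : ℤ) - c) * ((ν j : ℤ) - ν₀ j))
        = (∑ j : Fin n, ((j : ℤ) + 1) * ((ν j : ℤ) - ν₀ j))
          - (c + 1) * ∑ j, ((ν j : ℤ) - ν₀ j) := by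
      rw [Finset.mul_sum, ← Finset.sum_sub_distrib]
      exact Finset.sum_congr rfl fun j _ => by ring
    rw [this, hdeg']
    simpa using hw'
  have hzero := (Finset.sum_eq_zero_iff_of_nonneg hterm).1
    (le_antisymm hsum (Finset.sum_nonneg hterm))
  have hne : ∀ j, j ≠ c → (ν j : ℤ) - ν₀ j = 0 := by
    intro j hj
    rcases mul_eq_zero.1 (hzero j (Finset.mem_univ j)) with h0 | h0
    · exact absurd (Fin.ext (by omega)) hj
    · exact h0
  have heq : ν = ν₀ := by
    ext j
    by_cases hj : j = c
    · subst hj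
      rw [Finset.sum_eq_single j (fun i _ hi => hne i hi) (by simp)] at hdeg'
      omega
    · have := hne j hj
      omega
  subst heq
  exact ⟨rfl, add_left_cancel h⟩

end MultiIndex

/-! ### Multiplicative prolongations and their leading jets. -/

/-- The classes and principal jets exhibiting a system as involutive. -/
structure InvolutionData {k : Type*} [Field k] {n m p : ℕ} (q : ℕ) (Φ : Fin p → Fin m → Ops k n)
    where
  /-- The class of an equation, `⊥` for the equations of lower order. -/
  cls : Fin p → WithBot (Fin n)
  /-- The principal jet of an equation. -/
  pri : Fin p → Fin m × (Fin n →₀ ℕ)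
  totalDegree_le : ∀ τ a, (Φ τ a).totalDegree ≤ q
  class_le : ∀ τ a μ i, μ.degree = q → HasClass μ i → (Φ τ a).coeff μ ≠ 0 →
    (i : WithBot (Fin n)) ≤ cls τ
  solved : ∀ τ (i : Fin n), cls τ = i →
    (pri τ).2.degree = q ∧ HasClass (pri τ).2 i ∧
      ∀ σ, cls σ = i → (Φ σ (pri τ).1).coeff (pri τ).2 = if σ = τ then 1 else 0
  prolong : ∀ τ (j : Fin n), ¬ (j : WithBot (Fin n)) ≤ cls τ →
    (MvPolynomial.X j : Ops k n) • Φ τ ∈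
      Submodule.span k (Set.range Φ ∪
        {Ψ | ∃ σ, ∃ l : Fin n, (l : WithBot (Fin n)) ≤ cls σ ∧
          Ψ = (MvPolynomial.X l : Ops k n) • Φ σ})

namespace InvolutionData

variable {k : Type*} [Field k] {n m p q : ℕ} {Φ : Fin p → Fin m → Ops k n}

/-- The prolongation `d_ν Φ^τ`. -/
noncomputable def prolongation (Φ : Fin p → Fin m → Ops k n) (x : (Fin n →₀ ℕ) × Fin p) :
    Fin m → Ops k n :=
  (monomial x.1 1 : Ops k n) • Φ x.2

theorem prolongation_zero (τ : Fin p) : prolongation Φ (0, τ) = Φ τ := by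
  simp [prolongation]

theorem prolongation_single (l : Fin n) (τ : Fin p) :
    prolongation Φ (Finsupp.single l 1, τ) = (X l : Ops k n) • Φ τ := rfl

theorem prolongation_add (μ ν : Fin n →₀ ℕ) (τ : Fin p) :
    (monomial μ 1 : Ops k n) • prolongation Φ (ν, τ) = prolongation Φ (μ + ν, τ) := by
  simp [prolongation, smul_smul, monomial_mul]

variable (I : InvolutionData q Φ)

/-- The indices of the multiplicative prolongations. -/
def multiplicative : Set ((Fin n →₀ ℕ) × Fin p) :=
  {x | ∀ j, x.1 j ≠ 0 → (j : WithBot (Fin n)) ≤ I.cls x.2}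

include I in
theorem degree_le {τ : Fin p} {a : Fin m} {μ : Fin n →₀ ℕ} (h : (Φ τ a).coeff μ ≠ 0) :
    μ.degree ≤ q := by
  refine le_trans ?_ (I.totalDegree_le τ a)
  exact le_totalDegree (mem_support_iff.2 h)

theorem coeff_ne_zero_of_prolongation {x : (Fin n →₀ ℕ) × Fin p} {a : Fin m} {l : Fin n →₀ ℕ}
    (h : (prolongation Φ x a).coeff l ≠ 0) : ∃ μ, x.1 + μ = l ∧ (Φ x.2 a).coeff μ ≠ 0 := by
  simp only [prolongation, Pi.smul_apply, smul_eq_mul, coeff_monomial_mul', one_mul] at h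
  split_ifs at h with hle
  · exact ⟨l - x.1, add_tsub_cancel_of_le hle, h⟩
  · exact absurd rfl h

theorem coeff_prolongation_add (ν : Fin n →₀ ℕ) (τ : Fin p) (a : Fin m) (μ : Fin n →₀ ℕ) :
    (prolongation Φ (ν, τ) a).coeff (ν + μ) = (Φ τ a).coeff μ := by
  simp [prolongation, coeff_monomial_mul]

theorem coeff_linearCombination (c : (Fin n →₀ ℕ) × Fin p →₀ k) (a : Fin m) (l : Fin n →₀ ℕ) :
    (Finsupp.linearCombination k (prolongation Φ) c a).coeff l
      = ∑ x ∈ c.support, c x * (prolongation Φ x a).coeff l := by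
  simp [Finsupp.linearCombination_apply, Finsupp.sum, Finset.sum_apply, coeff_sum]

/-- The leading jets of a combination of multiplicative prolongations do not cancel. -/
theorem exists_coeff_ne_zero {c : (Fin n →₀ ℕ) × Fin p →₀ k}
    (hc : ∀ x ∈ c.support, x ∈ I.multiplicative) {x₀ : (Fin n →₀ ℕ) × Fin p}
    (hx₀ : x₀ ∈ c.support) (hcls : I.cls x₀.2 ≠ ⊥)
    (hmax : ∀ x ∈ c.support, x.1.degree ≤ x₀.1.degree ∧
      (x.1.degree = x₀.1.degree → indexWeight x.1 ≤ indexWeight x₀.1)) :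
    ∃ τ, (x₀.1, τ) ∈ c.support ∧ I.cls τ ≠ ⊥ ∧
      (Finsupp.linearCombination k (prolongation Φ) c (I.pri τ).1).coeff
        (x₀.1 + (I.pri τ).2) ≠ 0 := by
  classical
  obtain ⟨ν₀, τ₀⟩ := x₀
  -- Among the equations prolonged by `ν₀`, one of highest class is taken. Any other contribution to
  -- its leading jet comes, by `eq_of_add_eq_add`, from an equation containing the same principal
  -- jet. That equation has the same class, and the solved form rules it out.
  obtain ⟨τ, hτ, hτmax⟩ := Finset.exists_max_image
    (Finset.univ.filter fun τ => (ν₀, τ) ∈ c.support) I.cls ⟨τ₀, by simpa using hx₀⟩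
  simp only [Finset.mem_filter, Finset.mem_univ, true_and] at hτ hτmax
  have hbot : I.cls τ ≠ ⊥ := fun h => hcls (le_bot_iff.1 (h ▸ hτmax τ₀ hx₀))
  refine ⟨τ, hτ, hbot, ?_⟩
  obtain ⟨i, hi⟩ := WithBot.ne_bot_iff_exists.1 hbot
  obtain ⟨hdeg, hclass, hone⟩ := I.solved τ i hi.symm
  rw [coeff_linearCombination, Finset.sum_eq_single (ν₀, τ)]
  · rw [coeff_prolongation_add, hone τ hi.symm, if_pos rfl, mul_one]
    exact Finsupp.mem_support_iff.1 hτ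
  · rintro ⟨ν, σ⟩ hx hne
    by_contra hzero
    obtain ⟨μ, hadd, hμ⟩ := coeff_ne_zero_of_prolongation (right_ne_zero_of_mul hzero)
    obtain ⟨rfl, rfl⟩ := eq_of_add_eq_add hadd (hmax _ hx).1 ((I.degree_le hμ).trans hdeg.ge)
      (hmax _ hx).2 hclass (fun j hj => by
        have := hc _ hτ j hj
        rwa [← hi, WithBot.coe_le_coe] at this)
    have hle := I.class_le _ _ _ _ hdeg hclass hμ
    have heq : I.cls σ = i := le_antisymm (hi ▸ hτmax σ hx) hle
    have := hone σ heq
    rw [if_neg (by rintro rfl; exact hne rfl)] at this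
    exact hμ this
  · exact fun h => absurd hτ h

/-- A nonmultiplicative prolongation involves only prolongations in lower directions. -/
theorem smul_mem_span {τ : Fin p} {j : Fin n} (hj : ¬ (j : WithBot (Fin n)) ≤ I.cls τ) :
    (X j : Ops k n) • Φ τ ∈ Submodule.span k (prolongation Φ ''
      {x | x.1 = 0 ∨ ∃ l < j, x.1 = Finsupp.single l 1}) := by
  classical
  have hmem : (X j : Ops k n) • Φ τ ∈ Submodule.span k (prolongation Φ ''
      {x | x.1 = 0 ∨ ∃ l : Fin n, (l : WithBot (Fin n)) ≤ I.cls x.2 ∧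
        x.1 = Finsupp.single l 1}) := by
    refine Submodule.span_mono ?_ (I.prolong τ j hj)
    rintro _ (⟨σ, rfl⟩ | ⟨σ, l, hl, rfl⟩)
    · exact ⟨(0, σ), Or.inl rfl, prolongation_zero σ⟩
    · exact ⟨(Finsupp.single l 1, σ), Or.inr ⟨l, hl, rfl⟩, rfl⟩
  rw [Finsupp.mem_span_image_iff_linearCombination] at hmem ⊢
  obtain ⟨c, hc, hsum⟩ := hmem
  refine ⟨c, ?_, hsum⟩
  rw [Finsupp.mem_supported] at hc ⊢
  have hmult : ∀ x ∈ c.support, x ∈ I.multiplicative := by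
    intro x hx i hi
    rcases hc hx with h0 | ⟨l, hl, h1⟩
    · simp [h0] at hi
    · rw [h1, Finsupp.single_apply] at hi
      by_cases h : l = i
      · exact h ▸ hl
      · simp [h] at hi
  by_contra hnot
  obtain ⟨y, hy, hy'⟩ := Set.not_subset.1 hnot
  -- If a direction `≥ j` occurs, a term of maximal weight has a direction `l ≥ j`, and its
  -- uncancelled leading jet has class `l`. But the jets of order `q + 1` in `d_j Φ^τ` have class at
  -- most `cls τ < j`.
  obtain ⟨x₀, hx₀, hmax⟩ := Finset.exists_max_image c.support (fun x => indexWeight x.1) ⟨y, hy⟩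
  have hyx := hmax y hy
  have key : ∃ l : Fin n, (l : WithBot (Fin n)) ≤ I.cls x₀.2 ∧ x₀.1 = Finsupp.single l 1 ∧
      j ≤ l := by
    rcases hc hy with h0 | ⟨l', hl', h1'⟩
    · exact absurd (Or.inl h0) hy'
    have hjl : j ≤ l' := not_lt.1 fun h => hy' (Or.inr ⟨l', h, h1'⟩)
    rw [h1', indexWeight_single] at hyx
    rcases hc hx₀ with h0 | ⟨l, hl, h1⟩
    · rw [h0] at hyx
      simp [indexWeight] at hyx
    · rw [h1, indexWeight_single] at hyx
      exact ⟨l, hl, h1, hjl.trans (Fin.le_def.2 (by omega))⟩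
  obtain ⟨l, hl, h1, hjl⟩ := key
  obtain ⟨σ, hσ, hbot, hne⟩ := I.exists_coeff_ne_zero hmult hx₀
    (fun h => by rw [h, le_bot_iff] at hl; exact WithBot.coe_ne_bot hl) (fun x hx => by
      refine ⟨?_, fun _ => hmax x hx⟩
      rw [h1, Finsupp.degree_single]
      rcases hc hx with h0 | ⟨l, -, h1⟩
      · simp [h0]
      · simp [h1])
  rw [hsum, ← prolongation_single] at hne
  obtain ⟨μ, hμ, hcoeff⟩ := coeff_ne_zero_of_prolongation hne
  obtain ⟨i, hi⟩ := WithBot.ne_bot_iff_exists.1 hbot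
  obtain ⟨hdeg, hclass, -⟩ := I.solved σ i hi.symm
  simp only [h1] at hμ
  have hdegμ : μ.degree = q := by
    have := congrArg Finsupp.degree hμ
    simp only [map_add, Finsupp.degree_single, hdeg] at this
    omega
  have hil : l ≤ i := by
    have := hmult _ hσ l (by simp [h1])
    rwa [← hi, WithBot.coe_le_coe] at this
  by_cases hμ0 : μ = 0
  · subst hμ0
    have hq : q = 0 := by simpa using hdegμ.symm
    replace hdeg := (Finsupp.degree_eq_zero_iff _).1 (hdeg.trans hq)
    exact hclass.1 (by simp [hdeg])
  obtain ⟨e, he⟩ := exists_hasClass hμ0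
  have hle := I.class_le _ _ _ _ hdegμ he hcoeff
  have hej : e < j := WithBot.coe_lt_coe.1 (lt_of_le_of_lt hle (not_le.1 hj))
  have := DFunLike.congr_fun hμ e
  have h2 := hclass.2 e (hej.trans_le (hjl.trans hil))
  have h3 : Finsupp.single l 1 e = 0 := by
    rw [Finsupp.single_apply, if_neg (hej.trans_le hjl).ne']
  simp only [Finsupp.add_apply, h2, h3] at this
  exact he.1 (by omega)

/-- Replacing a nonmultiplicative `d_j` by lower directions, or by none, may create new
nonmultiplicative prolongations, but it strictly lowers the weight. -/
theorem prolongation_mem_span_multiplicative (x : (Fin n →₀ ℕ) × Fin p) :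
    prolongation Φ x ∈ Submodule.span k (prolongation Φ '' I.multiplicative) := by
  induction hw : indexWeight x.1 using Nat.strong_induction_on generalizing x with
  | _ w ih =>
  obtain ⟨ν, τ⟩ := x
  by_cases hm : (ν, τ) ∈ I.multiplicative
  · exact Submodule.subset_span ⟨_, hm, rfl⟩
  · simp only [multiplicative, Set.mem_ofPred_eq, not_forall] at hm
    obtain ⟨j, hj, hcls⟩ := hm
    obtain ⟨ν', rfl⟩ : ∃ ν', ν = ν' + Finsupp.single j 1 :=
      ⟨ν - Finsupp.single j 1, (tsub_add_cancel_of_le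
        (by rw [Finsupp.single_le_iff]; omega)).symm⟩
    rw [← prolongation_add, prolongation_single]
    have := Submodule.mem_map_of_mem
      (f := LinearMap.restrictScalars k (LinearMap.lsmul (Ops k n) (Fin m → Ops k n)
        (monomial ν' 1))) (I.smul_mem_span hcls)
    rw [Submodule.map_span] at this
    refine Submodule.span_le.2 ?_ this
    rintro _ ⟨_, ⟨⟨ν'', σ⟩, hν'', rfl⟩, rfl⟩
    change (monomial ν' 1 : Ops k n) • prolongation Φ (ν'', σ) ∈ _
    rw [prolongation_add]
    refine ih _ ?_ _ rfl
    rw [← hw]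
    simp only [indexWeight_add, indexWeight_single]
    rcases hν'' with rfl | ⟨l, hl, rfl⟩
    · simp [indexWeight]
    · have : (l : ℕ) < j := hl
      rw [indexWeight_single]
      omega

theorem mem_span_multiplicative {y : Fin m → Ops k n}
    (hy : y ∈ Submodule.span (Ops k n) (Set.range Φ)) :
    y ∈ Submodule.span k (prolongation Φ '' I.multiplicative) := by
  obtain ⟨f, rfl⟩ := (Submodule.mem_span_range_iff_exists_fun _).1 hy
  refine Submodule.sum_mem _ fun τ _ => ?_
  rw [(f τ).as_sum, Finset.sum_smul]
  refine Submodule.sum_mem _ fun ν _ => ?_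
  have : (monomial ν ((f τ).coeff ν) : Ops k n) • Φ τ = (f τ).coeff ν • prolongation Φ (ν, τ) := by
    rw [prolongation, ← smul_assoc, smul_monomial, smul_eq_mul, mul_one]
  rw [this]
  exact Submodule.smul_mem _ _ (I.prolongation_mem_span_multiplicative _)

/-- An element of `DΦ` of order at least `q` contains a multiplicative derivative of a principal
jet. -/
theorem exists_principal_coeff_ne_zero (hq : 1 ≤ q) {y : Fin m → Ops k n}
    (hy : y ∈ Submodule.span (Ops k n) (Set.range Φ)) {b : Fin m} {l : Fin n →₀ ℕ}
    (hl : q ≤ l.degree) (hb : (y b).coeff l ≠ 0) :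
    ∃ ν τ i, I.cls τ = (i : Fin n) ∧ (∀ j, ν j ≠ 0 → j ≤ i) ∧
      (y (I.pri τ).1).coeff (ν + (I.pri τ).2) ≠ 0 := by
  classical
  have hmem := I.mem_span_multiplicative hy
  rw [Finsupp.mem_span_image_iff_linearCombination] at hmem
  obtain ⟨c, hc, rfl⟩ := hmem
  rw [Finsupp.mem_supported] at hc
  have hzero : ∀ x ∈ c.support, I.cls x.2 = ⊥ → x.1 = 0 := by
    intro x hx hbot
    ext j
    by_contra hj
    have := hc hx j hj
    rw [hbot, le_bot_iff] at this
    exact WithBot.coe_ne_bot this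
  by_cases hex : ∃ x ∈ c.support, I.cls x.2 ≠ ⊥
  · obtain ⟨x, hx, hxb⟩ := hex
    -- Degree is compared first, then weight. The remaining equations occur only unprolonged, so
    -- they never exceed this maximum.
    obtain ⟨x₀, hx₀, hmax⟩ := Finset.exists_max_image (c.support.filter fun x => I.cls x.2 ≠ ⊥)
      (fun x => toLex (x.1.degree, indexWeight x.1)) ⟨x, by simp [hxb, Finsupp.mem_support_iff.1 hx]⟩
    rw [Finset.mem_filter] at hx₀
    obtain ⟨τ, hτ, hbot, hne⟩ := I.exists_coeff_ne_zero (fun x hx => hc hx) hx₀.1 hx₀.2 (by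
      intro x hx
      by_cases hxb : I.cls x.2 = ⊥
      · rw [hzero x hx hxb]
        simp [indexWeight]
      · have := hmax x (Finset.mem_filter.2 ⟨hx, hxb⟩)
        rw [Prod.Lex.toLex_le_toLex] at this
        simp only at this
        omega)
    obtain ⟨i, hi⟩ := WithBot.ne_bot_iff_exists.1 hbot
    refine ⟨x₀.1, τ, i, hi.symm, fun j hj => ?_, hne⟩
    have := hc hτ j hj
    rwa [← hi, WithBot.coe_le_coe] at this
  -- Only unprolonged remaining equations are left, and these contain no jet of order `q`. Here `q ≥
  -- 1` matters: the zero multi-index has no class.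
  · exfalso
    push Not at hex
    rw [coeff_linearCombination] at hb
    obtain ⟨x, hx, hne⟩ := Finset.exists_ne_zero_of_sum_ne_zero hb
    obtain ⟨μ, hμ, hcoeff⟩ := coeff_ne_zero_of_prolongation (right_ne_zero_of_mul hne)
    rw [hzero x hx (hex x hx), zero_add] at hμ
    subst hμ
    have hdeg := le_antisymm (I.degree_le hcoeff) hl
    obtain ⟨i, hi⟩ := exists_hasClass (μ := μ) (by
      rintro rfl
      simp at hl
      omega)
    have := I.class_le _ _ _ _ hdeg hi hcoeff
    rw [hex x hx, le_bot_iff] at this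
    exact WithBot.coe_ne_bot this

/-- The derivatives of a parametric jet of class `i` with respect to `d₁, …, dᵢ` are linearly
independent in the differential module. -/
theorem eq_zero_of_smul_parametric_mem (hq : 1 ≤ q) {a : Fin m} {μ : Fin n →₀ ℕ} {i : Fin n}
    (hdeg : μ.degree = q) (hμ : HasClass μ i) (hpar : ∀ τ, I.cls τ = i → I.pri τ ≠ (a, μ))
    {f : Ops k n} (hf : f ∈ FirstVars k n (i + 1))
    (hmem : f • (Pi.single a (monomial μ 1) : Fin m → Ops k n) ∈
      Submodule.span (Ops k n) (Set.range Φ)) : f = 0 := by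
  classical
  by_contra hf0
  obtain ⟨ν', hν'⟩ := ne_zero_iff.1 hf0
  have hcoeff : ∀ l, ((f • (Pi.single a (monomial μ 1) : Fin m → Ops k n)) a).coeff l
      = if μ ≤ l then f.coeff (l - μ) else 0 := fun l => by
    simp [coeff_mul_monomial']
  obtain ⟨ν, τ, c, hcls, hν, hne⟩ := I.exists_principal_coeff_ne_zero hq hmem (b := a)
    (l := ν' + μ) (by simp [hdeg]) (by rw [hcoeff]; simpa using hν')
  have ha : (I.pri τ).1 = a := by
    by_contra hna
    simp [Pi.single_eq_of_ne hna] at hne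
  rw [ha, hcoeff] at hne
  split_ifs at hne with hle
  · obtain ⟨hd, hc, -⟩ := I.solved τ c hcls
    set ξ := ν + (I.pri τ).2 - μ with hξ
    have hadd : ξ + μ = ν + (I.pri τ).2 := tsub_add_cancel_of_le hle
    have hξi : ∀ j, ξ j ≠ 0 → j ≤ i := by
      intro j hj
      rw [mem_supported] at hf
      have : j ∈ f.vars := (mem_vars_iff_mem_support j).2 ⟨ξ, mem_support_iff.2 hne, by simpa using hj⟩
      have h2 : (j : ℕ) < i + 1 := hf this
      exact Fin.le_def.2 (by omega)
    have hdd : ξ.degree = ν.degree := by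
      have := congrArg Finsupp.degree hadd
      simp only [map_add] at this
      omega
    -- Both splittings of the same multi-index are multiplicative, so `eq_of_add_eq_add` applies in
    -- whichever direction the weights compare.
    have hpri : μ = (I.pri τ).2 := by
      rcases le_total (indexWeight ξ) (indexWeight ν) with hw | hw
      · exact (eq_of_add_eq_add hadd hdd.le (by omega) (fun _ => hw) hc hν).2
      · exact (eq_of_add_eq_add hadd.symm hdd.ge (by omega) (fun _ => hw) hμ hξi).2.symm
    have hci : c = i := hc.unique (hpri ▸ hμ)
    exact hpar τ (hci ▸ hcls) (Prod.ext ha hpri.symm)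
  · exact hne rfl

end InvolutionData

/-! ### Transcendence degree of `D / 𝔭` and the first `s` variables. -/

section TranscendenceDegree

variable {k : Type*} [Field k] {n : ℕ}

theorem trdeg_fractionRing_quotient (P : Ideal (Ops k n)) [P.IsPrime] :
    Algebra.trdeg k (FractionRing (Ops k n ⧸ P)) = Algebra.trdeg k (Ops k n ⧸ P) := by
  have : Algebra.IsAlgebraic (Ops k n ⧸ P) (FractionRing (Ops k n ⧸ P)) :=
    (IsFractionRing.comap_isAlgebraic_iff (K := FractionRing (Ops k n ⧸ P))).2 inferInstance
  rw [← trdeg_add_eq k (Ops k n ⧸ P) (A := FractionRing (Ops k n ⧸ P)),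
    trdeg_eq_zero (R := Ops k n ⧸ P), add_zero]

/-- Needed because `Cardinal.toNat` sends infinite cardinals to `0`. -/
theorem trdeg_quotient_lt_aleph0 (P : Ideal (Ops k n)) :
    Algebra.trdeg k (Ops k n ⧸ P) < Cardinal.aleph0 :=
  trdeg_lt_aleph0_of_finiteType

theorem primeCodim_eq (P : Ideal (Ops k n)) [P.IsPrime] :
    primeCodim P = n - Cardinal.toNat (Algebra.trdeg k (Ops k n ⧸ P)) := by
  rw [primeCodim, trdeg_fractionRing_quotient]

/-- The residue classes of the first `s` variables. -/
noncomputable def residueVars (P : Ideal (Ops k n)) (s : ℕ) (i : {i : Fin n // (i : ℕ) < s}) : Ops k n ⧸ P :=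
  Ideal.Quotient.mk P (X i.1)

theorem card_residueVars {s : ℕ} (hs : s ≤ n) : Fintype.card {i : Fin n // (i : ℕ) < s} = s := by
  rw [Fintype.card_subtype, Fin.card_filter_val_lt, min_eq_right hs]

theorem aeval_residueVars (P : Ideal (Ops k n)) (s : ℕ)
    (f : MvPolynomial {i : Fin n // (i : ℕ) < s} k) :
    aeval (residueVars P s) f = Ideal.Quotient.mk P (rename Subtype.val f) := by
  have : aeval (residueVars P s)
      = (Ideal.Quotient.mkₐ k P).comp (rename (R := k) Subtype.val) := by
    ext i
    simp [residueVars]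
  rw [this]
  rfl

theorem algebraicIndependent_residueVars_iff {P : Ideal (Ops k n)} {s : ℕ} :
    AlgebraicIndependent k (residueVars P s) ↔ ∀ f ∈ FirstVars k n s, f ∈ P → f = 0 := by
  rw [algebraicIndependent_iff]
  simp only [aeval_residueVars, Ideal.Quotient.eq_zero_iff_mem]
  constructor
  · intro h f hf hfP
    rw [FirstVars, supported_eq_range_rename] at hf
    obtain ⟨g, rfl⟩ := hf
    rw [h g hfP, map_zero]
  · intro h f hf
    have := h _ (by rw [FirstVars, supported_eq_range_rename]; exact ⟨f, rfl⟩) hf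
    exact (map_eq_zero_iff _ (rename_injective _ Subtype.val_injective)).1 this

theorem le_toNat_trdeg {P : Ideal (Ops k n)} {s : ℕ} (hs : s ≤ n)
    (h : ∀ f ∈ FirstVars k n s, f ∈ P → f = 0) :
    s ≤ Cardinal.toNat (Algebra.trdeg k (Ops k n ⧸ P)) := by
  have := (algebraicIndependent_residueVars_iff.2 h).lift_cardinalMk_le_trdeg
  rw [← Cardinal.cast_toNat_of_lt_aleph0 (trdeg_quotient_lt_aleph0 P)] at this
  simpa [card_residueVars hs] using this

theorem isIntegral_adjoin_residueVars {P : Ideal (Ops k n)} {s : ℕ}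
    (h : ∀ d : Ops k n, ∃ f : Polynomial (FirstVars k n s), f.Monic ∧ Polynomial.aeval d f ∈ P) :
    Algebra.IsIntegral (Algebra.adjoin k (Set.range (residueVars P s))) (Ops k n ⧸ P) := by
  have hmem : ∀ a : FirstVars k n s, (Ideal.Quotient.mkₐ k P).comp (FirstVars k n s).val a ∈
      Algebra.adjoin k (Set.range (residueVars P s)) := by
    rintro ⟨a, ha⟩
    rw [FirstVars, supported_eq_range_rename] at ha
    obtain ⟨g, rfl⟩ := ha
    rw [Algebra.adjoin_range_eq_range_aeval]
    exact ⟨g, aeval_residueVars P s g⟩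
  refine ⟨fun b => ?_⟩
  obtain ⟨d, rfl⟩ := Ideal.Quotient.mk_surjective b
  obtain ⟨f, hf, hfd⟩ := h d
  refine ⟨f.map (AlgHom.codRestrict _ _ hmem : _ →ₐ[k] _).toRingHom, hf.map _, ?_⟩
  rw [Polynomial.eval₂_map, ← Ideal.Quotient.eq_zero_iff_mem.2 hfd, Polynomial.aeval_def,
    Polynomial.hom_eval₂]
  rfl

theorem toNat_trdeg_le {P : Ideal (Ops k n)} [P.IsPrime] {s : ℕ} (hs : s ≤ n)
    (h : ∀ d : Ops k n, ∃ f : Polynomial (FirstVars k n s), f.Monic ∧ Polynomial.aeval d f ∈ P) :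
    Cardinal.toNat (Algebra.trdeg k (Ops k n ⧸ P)) ≤ s := by
  have := isIntegral_adjoin_residueVars h
  have h1 := Algebra.IsAlgebraic.trdeg_le_cardinalMk k (Set.range (residueVars P s))
  have h2 := Cardinal.mk_range_le_lift (f := residueVars P s)
  rw [← Cardinal.cast_toNat_of_lt_aleph0 (trdeg_quotient_lt_aleph0 P)] at h1
  have h3 := (Cardinal.lift_le.2 h1).trans h2
  simpa [card_residueVars hs] using h3

/-- If the degree were `s`, the `s` residue classes, over which `D / P` is integral, would form a
transcendence basis, and `f` would be an algebraic relation between them. -/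
theorem toNat_trdeg_lt {P : Ideal (Ops k n)} [P.IsPrime] {s : ℕ} (hs : s ≤ n)
    (h : ∀ d : Ops k n, ∃ f : Polynomial (FirstVars k n s), f.Monic ∧ Polynomial.aeval d f ∈ P)
    {f : Ops k n} (hf : f ∈ FirstVars k n s) (hfP : f ∈ P) (hf0 : f ≠ 0) :
    Cardinal.toNat (Algebra.trdeg k (Ops k n ⧸ P)) < s := by
  refine lt_of_le_of_ne (toNat_trdeg_le hs h) fun heq => hf0 ?_
  have := isIntegral_adjoin_residueVars h
  have hbasis := Algebra.IsAlgebraic.isTranscendenceBasis_of_lift_le_trdeg_of_finite k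
    (residueVars P s) (by
      rw [← Cardinal.cast_toNat_of_lt_aleph0 (trdeg_quotient_lt_aleph0 P), heq]
      simp [card_residueVars hs])
  exact algebraicIndependent_residueVars_iff.1 hbasis.1 f hf hfP

end TranscendenceDegree

/-! ### Codimension, purity and torsion. -/

section Codimension

variable {k : Type*} [Field k] {n : ℕ} {M : Type*} [AddCommGroup M] [Module (Ops k n) M]

/-- Some prime over the annihilator avoids the nonzero elements of `k[χ₁, …, χₜ]`. So does a minimal
prime below it, whose quotient therefore has transcendence degree at least `t`. -/
theorem codim_le_of_faithful {t : ℕ} (ht : t ≤ n)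
    (h : ∀ f ∈ FirstVars k n t, f ∈ Module.annihilator (Ops k n) M → f = 0) :
    codim (k := k) (n := n) M ≤ (n - t : ℕ) := by
  obtain ⟨P, hP, hle, hdisj⟩ := Ideal.exists_le_prime_disjoint (Module.annihilator (Ops k n) M)
    ((nonZeroDivisors (FirstVars k n t)).map (FirstVars k n t).val) (by
      rw [Set.disjoint_left]
      rintro _ hf ⟨a, ha, rfl⟩
      exact nonZeroDivisors.ne_zero ha (Subtype.ext (h _ a.2 hf)))
  obtain ⟨Q, hQ, hQP⟩ := Ideal.exists_minimalPrimes_le hle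
  have := hQ.1.1
  refine (iInf₂_le Q hQ).trans ?_
  rw [primeCodim_eq, Nat.cast_le]
  refine Nat.sub_le_sub_left (le_toNat_trdeg ht fun f hf hfQ => ?_) n
  by_contra hf0
  exact Set.disjoint_left.1 hdisj (hQP hfQ)
    ⟨⟨f, hf⟩, mem_nonZeroDivisors_of_ne_zero fun h0 => hf0 (congrArg Subtype.val h0), rfl⟩

theorem le_of_codim_eq {r : ℕ} (h : codim (k := k) (n := n) M = (r : ℕ∞)) : r ≤ n := by
  by_cases hne : ∃ P, P ∈ (Module.annihilator (Ops k n) M).minimalPrimes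
  · obtain ⟨P, hP⟩ := hne
    have : (r : ℕ∞) ≤ primeCodim P := h ▸ iInf₂_le P hP
    exact (Nat.cast_le.1 this).trans (Nat.sub_le _ _)
  -- Without minimal primes the infimum is `⊤`, which is not `r`.
  · push Not at hne
    simp [codim, hne] at h

/-- Cayley–Hamilton for multiplication by `d` on a finite module. -/
theorem exists_monic_aeval_mem_annihilator {s : ℕ} [Module.Finite (FirstVars k n s) M]
    (d : Ops k n) : ∃ f : Polynomial (FirstVars k n s), f.Monic ∧
      Polynomial.aeval d f ∈ Module.annihilator (Ops k n) M := by
  obtain ⟨f, hf, h0⟩ := LinearMap.exists_monic_and_aeval_eq_zero (FirstVars k n s)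
    (Algebra.lsmul (FirstVars k n s) (FirstVars k n s) M d)
  refine ⟨f, hf, Module.mem_annihilator.2 fun x => ?_⟩
  rw [Polynomial.aeval_algHom_apply] at h0
  exact LinearMap.congr_fun h0 x

theorem tmul_one_eq_zero_iff {R N : Type*} [CommRing R] [IsDomain R] [AddCommGroup N] [Module R N]
    (x : N) : TensorProduct.tmul R (1 : FractionRing R) x = 0 ↔ ∃ f : R, f ≠ 0 ∧ f • x = 0 := by
  have : TensorProduct.tmul R (1 : FractionRing R) x = TensorProduct.mk R (FractionRing R) N 1 x :=
    rfl
  rw [this, IsLocalizedModule.eq_zero_iff (nonZeroDivisors R)]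
  exact ⟨fun ⟨c, hc⟩ => ⟨c, nonZeroDivisors.ne_zero c.2, hc⟩,
    fun ⟨f, hf, hfx⟩ => ⟨⟨f, mem_nonZeroDivisors_of_ne_zero hf⟩, hfx⟩⟩

theorem injective_toPartialLocalization_iff {s : ℕ} :
    Function.Injective (toPartialLocalization k n s M) ↔
      ∀ x : M, ∀ f ∈ FirstVars k n s, f • x = 0 → f = 0 ∨ x = 0 := by
  have : Function.Injective (toPartialLocalization k n s M) ↔ Function.Injective
    (TensorProduct.mk (FirstVars k n s) (FractionRing (FirstVars k n s)) M 1) := Iff.rfl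
  rw [this, injective_iff_map_eq_zero]
  constructor
  · intro h x f hf hfx
    by_cases hf0 : f = 0
    · exact Or.inl hf0
    · exact Or.inr (h x ((tmul_one_eq_zero_iff x).2
        ⟨⟨f, hf⟩, fun h0 => hf0 (congrArg Subtype.val h0), hfx⟩))
  · intro h x hx
    obtain ⟨⟨f, hf⟩, hf0, hfx⟩ := (tmul_one_eq_zero_iff x).1 hx
    exact (h x f hf hfx).resolve_left fun h0 => hf0 (Subtype.ext h0)

/-- Over a Noether normalization by the first `n - r` variables, `r`-purity is torsion-freeness. -/
theorem isPure_iff_injective {r : ℕ} (hr : r ≤ n) [Module.Finite (FirstVars k n (n - r)) M] :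
    IsPure k n r M ↔ Function.Injective (toPartialLocalization k n (n - r) M) := by
  have hint : ∀ (x : M) (P : Ideal (Ops k n)),
      Module.annihilator (Ops k n) (Submodule.span (Ops k n) {x}) ≤ P → ∀ d : Ops k n,
        ∃ f : Polynomial (FirstVars k n (n - r)), f.Monic ∧ Polynomial.aeval d f ∈ P := by
    intro x P hP d
    obtain ⟨f, hf, h0⟩ := exists_monic_aeval_mem_annihilator (M := M) (s := n - r) d
    exact ⟨f, hf, hP (LinearMap.annihilator_le_of_injective
      (Submodule.span (Ops k n) {x}).subtype Subtype.val_injective h0)⟩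
  have hann : ∀ (x : M) (f : Ops k n),
      f ∈ Module.annihilator (Ops k n) (Submodule.span (Ops k n) {x}) ↔ f • x = 0 := by
    intro x f
    exact Submodule.mem_annihilator_span_singleton x f
  rw [injective_toPartialLocalization_iff]
  constructor
  -- A torsion relation `f • x = 0` puts `f` in every minimal prime of `ann(Dx)`, so the codimension
  -- of `Dx` is at least `r + 1`.
  · intro hpure x f hf hfx
    by_contra! hne
    have hx := hpure x hne.2
    have : ((r + 1 : ℕ) : ℕ∞) ≤ codim (k := k) (n := n) (Submodule.span (Ops k n) {x}) := by
      refine le_iInf₂ fun P hP => ?_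
      have := hP.1.1
      have hlt := toNat_trdeg_lt (Nat.sub_le n r) (hint x P hP.1.2) hf
        (hP.1.2 ((hann x f).2 hfx)) hne.1
      rw [primeCodim_eq, Nat.cast_le]
      omega
    rw [hx, Nat.cast_le] at this
    omega
  -- The upper bound comes from torsion-freeness, the lower one from integrality alone.
  · intro h x hx
    refine le_antisymm ?_ (le_iInf₂ fun P hP => ?_)
    · have := codim_le_of_faithful (M := Submodule.span (Ops k n) {x}) (Nat.sub_le n r)
        fun f hf hfx => (h x f hf ((hann x f).1 hfx)).resolve_right hx
      rwa [Nat.sub_sub_self hr] at this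
    · have := hP.1.1
      have hle := toNat_trdeg_le (Nat.sub_le n r) (hint x P hP.1.2)
      rw [primeCodim_eq, Nat.cast_le]
      omega

end Codimension

/-! ### Finite generation over the first derivations. -/

namespace InvolutionData

variable {k : Type*} [Field k] {n m p q : ℕ} {Φ : Fin p → Fin m → Ops k n}

/-- The residue class of the jet `y^a_μ` in the differential module. -/
noncomputable def jet (Φ : Fin p → Fin m → Ops k n) (a : Fin m) (μ : Fin n →₀ ℕ) : SysModule Φ :=
  Submodule.Quotient.mk (Pi.single a (monomial μ 1))

theorem X_smul_jet (j : Fin n) (a : Fin m) (μ : Fin n →₀ ℕ) :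
    (X j : Ops k n) • jet Φ a μ = jet Φ a (Finsupp.single j 1 + μ) := by
  rw [jet, ← Submodule.Quotient.mk_smul, ← Pi.single_smul, smul_eq_mul, X, monomial_mul, one_mul,
    jet]

theorem mk_eq_sum_jet (y : Fin m → Ops k n) :
    (Submodule.Quotient.mk y : SysModule Φ)
      = ∑ a, ∑ μ ∈ (y a).support, (y a).coeff μ • jet Φ a μ := by
  have hy : y = ∑ a, ∑ μ ∈ (y a).support,
      (y a).coeff μ • (Pi.single a (monomial μ 1) : Fin m → Ops k n) := by
    conv_lhs => rw [← Finset.univ_sum_single y]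
    refine Finset.sum_congr rfl fun a _ => ?_
    conv_lhs => rw [(y a).as_sum]
    refine (map_sum (LinearMap.single k (fun _ : Fin m => Ops k n) a) _ _).trans
      (Finset.sum_congr rfl fun μ _ => ?_)
    rw [LinearMap.single_apply, ← Pi.single_smul, smul_monomial, smul_eq_mul, mul_one]
  have := congrArg (Submodule.mkQ (Submodule.span (Ops k n) (Set.range Φ))) hy
  simp only [map_sum] at this
  exact this

variable (I : InvolutionData q Φ)

/-- If all the jets of order `q` and class `> s` are principal, then the differential module is
finitely generated over the ring generated by the first `s` derivations. -/
theorem finite_firstVars (hq : 1 ≤ q) {s : ℕ}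
    (h : ∀ a μ (i : Fin n), μ.degree = q → HasClass μ i → s ≤ i →
      ∃ τ, I.cls τ = i ∧ I.pri τ = (a, μ)) :
    Module.Finite (FirstVars k n s) (SysModule Φ) := by
  classical
  set S : Set (SysModule Φ) :=
    (fun x : Fin m × (Fin n →₀ ℕ) => jet Φ x.1 x.2) '' (Set.univ ×ˢ {μ | μ.degree ≤ q}) with hS
  have hfin : S.Finite := (Set.finite_univ.prod (Finsupp.finite_of_degree_le q)).image _
  set W := Submodule.span (FirstVars k n s) S with hW
  have hjet : ∀ a μ, μ.degree ≤ q → jet Φ a μ ∈ W := fun a μ hμ =>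
    Submodule.subset_span ⟨(a, μ), ⟨trivial, hμ⟩, rfl⟩
  have hX : ∀ j : Fin n, (j : ℕ) < s → ∀ w ∈ W, (X j : Ops k n) • w ∈ W := fun j hj w hw =>
    W.smul_mem (⟨X j, X_mem_supported.2 hj⟩ : FirstVars k n s) hw
  have hk : ∀ (c : k), ∀ w ∈ W, c • w ∈ W := fun c w hw =>
    (W.restrictScalars k).smul_mem c hw
  have hlow : ∀ (j : Fin n) a μ, μ.degree < q → (X j : Ops k n) • jet Φ a μ ∈ W := by
    intro j a μ hμ
    rw [X_smul_jet]
    refine hjet _ _ ?_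
    rw [map_add, Finsupp.degree_single]
    omega
  have htop : ∀ (j i : Fin n) a μ, μ.degree = q → HasClass μ i →
      (X j : Ops k n) • jet Φ a μ ∈ W := by
    intro j i
    induction i using WellFoundedLT.induction with
    | _ i ih =>
    intro a μ hdeg hμ
    -- In low class, one `χᵢ` is traded for `χⱼ`: the jet stays of order `q` and `χᵢ` is a scalar.
    -- In high class, the jet is eliminated through its equation.
    by_cases his : (i : ℕ) < s
    · obtain ⟨μ', rfl⟩ : ∃ μ', μ = Finsupp.single i 1 + μ' :=
        ⟨μ - Finsupp.single i 1, (add_tsub_cancel_of_le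
          (by rw [Finsupp.single_le_iff]; exact Nat.one_le_iff_ne_zero.2 hμ.1)).symm⟩
      rw [← X_smul_jet, smul_comm, X_smul_jet]
      refine hX i his _ (hjet _ _ ?_)
      simp only [map_add, Finsupp.degree_single] at hdeg ⊢
      exact hdeg.le
    · obtain ⟨τ, hτ, hpri⟩ := h a μ i hdeg hμ (not_lt.1 his)
      obtain ⟨-, -, hone⟩ := I.solved τ i hτ
      rw [hpri] at hone
      simp only at hone
      have hmem : μ ∈ (Φ τ a).support := by
        rw [mem_support_iff, hone τ hτ, if_pos rfl]
        exact one_ne_zero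
      have hzero : (0 : SysModule Φ)
          = ∑ b, ∑ ν ∈ (Φ τ b).support, (Φ τ b).coeff ν • jet Φ b ν := by
        rw [← mk_eq_sum_jet]
        exact ((Submodule.Quotient.mk_eq_zero _).2 (Submodule.subset_span (Set.mem_range_self τ))).symm
      have hterm : ∀ b ν, (b, ν) ≠ (a, μ) → ν ∈ (Φ τ b).support →
          (X j : Ops k n) • (Φ τ b).coeff ν • jet Φ b ν ∈ W := by
        intro b ν hne hν
        rw [smul_comm]
        refine hk _ _ ?_
        rw [mem_support_iff] at hν
        rcases (I.degree_le hν).lt_or_eq with hlt | heq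
        · exact hlow j b ν hlt
        by_cases hν0 : ν = 0
        · subst hν0
          have : μ = 0 := (Finsupp.degree_eq_zero_iff _).1 (hdeg.trans (heq.symm.trans (map_zero _)))
          exact absurd (by rw [this]; rfl) hμ.1
        obtain ⟨e, he⟩ := exists_hasClass hν0
        have hle := I.class_le _ _ _ _ heq he hν
        rw [hτ, WithBot.coe_le_coe] at hle
        rcases hle.lt_or_eq with hlt | rfl
        · exact ih e hlt b ν heq he
        -- A jet of the same class is principal for another equation, hence absent from this one.
        -- Only jets of lower class or lower order survive.
        obtain ⟨σ, hσ, hpri'⟩ := h b ν e heq he (not_lt.1 his)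
        have hc := (I.solved σ e hσ).2.2 τ hτ
        rw [hpri'] at hc
        simp only at hc
        split_ifs at hc with hστ
        · subst hστ
          exact absurd (hpri'.symm.trans hpri) hne
        · exact absurd hc hν
      rw [← Finset.add_sum_erase _ _ (Finset.mem_univ a), ← Finset.add_sum_erase _ _ hmem,
        hone τ hτ, if_pos rfl, one_smul, add_assoc] at hzero
      rw [eq_neg_of_add_eq_zero_left hzero.symm, smul_neg, smul_add, Finset.smul_sum,
        Finset.smul_sum]
      refine W.neg_mem (W.add_mem (W.sum_mem fun ν hν => ?_) (W.sum_mem fun b hb => ?_))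
      · rw [Finset.mem_erase] at hν
        exact hterm a ν (fun h => hν.1 (congrArg Prod.snd h)) hν.2
      · rw [Finset.smul_sum]
        refine W.sum_mem fun ν hν => hterm b ν (fun h => ?_) hν
        exact (Finset.mem_erase.1 hb).1 (congrArg Prod.fst h)
  have hstep : ∀ (j : Fin n), ∀ w ∈ W, (X j : Ops k n) • w ∈ W := by
    intro j w hw
    induction hw using Submodule.span_induction with
    | mem w hw =>
      obtain ⟨⟨a, μ⟩, ⟨-, hμ⟩, rfl⟩ := hw
      rcases (show μ.degree ≤ q from hμ).lt_or_eq with hlt | heq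
      · exact hlow j a μ hlt
      by_cases hμ0 : μ = 0
      · subst hμ0
        rw [map_zero] at heq
        omega
      obtain ⟨i, hi⟩ := exists_hasClass hμ0
      exact htop j i a μ heq hi
    | zero => simp
    | add x y _ _ hx hy => rw [smul_add]; exact W.add_mem hx hy
    | smul c x _ hx => rw [smul_comm]; exact W.smul_mem c hx
  have hall : ∀ (μ : Fin n →₀ ℕ) a, jet Φ a μ ∈ W := by
    intro μ a
    induction hd : μ.degree generalizing μ with
    | zero => exact hjet _ _ (by omega)
    | succ d ih =>
      have hμ0 : μ ≠ 0 := by rintro rfl; simp at hd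
      obtain ⟨j, hj⟩ := exists_hasClass hμ0
      obtain ⟨μ', rfl⟩ : ∃ μ', μ = Finsupp.single j 1 + μ' :=
        ⟨μ - Finsupp.single j 1, (add_tsub_cancel_of_le
          (by rw [Finsupp.single_le_iff]; exact Nat.one_le_iff_ne_zero.2 hj.1)).symm⟩
      rw [← X_smul_jet]
      refine hstep j _ (ih μ' ?_)
      simp only [map_add, Finsupp.degree_single] at hd
      omega
  refine ⟨⟨hfin.toFinset, ?_⟩⟩
  rw [hfin.coe_toFinset, eq_top_iff]
  rintro x -
  obtain ⟨y, rfl⟩ := Submodule.Quotient.mk_surjective _ x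
  rw [mk_eq_sum_jet]
  exact W.sum_mem fun a _ => W.sum_mem fun μ _ => hk _ _ (hall μ a)

end InvolutionData

end PartialLocalization

theorem corollary3p10 {k : Type*} [Field k] [CharZero k] (n m p q r : ℕ) (hq : 1 ≤ q)
    (Φ : Fin p → Fin m → PartialLocalization.Ops k n)
    (hΦ : PartialLocalization.IsInvolutive q Φ)
    (hr : PartialLocalization.codim (k := k) (n := n) (PartialLocalization.SysModule Φ)
      = (r : ℕ∞)) :
    PartialLocalization.IsPure k n r (PartialLocalization.SysModule Φ) ↔
      Function.Injective (PartialLocalization.toPartialLocalization k n (n - r)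
        (PartialLocalization.SysModule Φ)) := by
  open PartialLocalization in
  obtain ⟨cls, pri, h₁, h₂, h₃, h₄⟩ := hΦ
  let I : InvolutionData q Φ := ⟨cls, pri, h₁, h₂, h₃, h₄⟩
  have hrn : r ≤ n := le_of_codim_eq hr
  have hfin : Module.Finite (FirstVars k n (n - r)) (SysModule Φ) := by
    refine I.finite_firstVars hq fun a μ i hdeg hμ hi => ?_
    by_contra! hpar
    -- Indices start at `0`, so a parametric jet here makes `M` faithful over `i + 1 > n - r`
    -- variables, and its codimension drops below `r`.
    have hle : codim (k := k) (n := n) (SysModule Φ) ≤ (n - (i + 1) : ℕ) := by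
      refine codim_le_of_faithful i.2 fun f hf hann => ?_
      refine I.eq_zero_of_smul_parametric_mem hq hdeg hμ hpar hf ?_
      rw [← Submodule.Quotient.mk_eq_zero, Submodule.Quotient.mk_smul]
      exact Module.mem_annihilator.1 hann _
    rw [hr, Nat.cast_le] at hle
    have := i.2
    omega
  exact isPure_iff_injective hrn
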